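/- Let $N\ge 1$ and let $\alpha>-1/2$ be real. The symmetric Cauchy ensemble with $\beta=2$ has eigenvalue density $$\rho_{(1)}(x)=\frac{N}{\mathcal N_N}\int_{\mathbb R^{N-1}} \prod_{l=1}^N(1+x_l^2)^{-N-\alpha}\prod_{1\le j<k\le N}|x_k-x_j|^2\,dx_2\cdots dx_N,\qquad x_1=x,$$ where $\mathcal N_N$ is the normalisation for which $\rho_{(1)}$ has integral $N$. Put $m_k=\int_{\mathbb R}y^k\rho_{(1)}(y)\,dy$ and let $W_1(x)=\sum_{k\ge 0}m_k x^{-k-1}$, a formal series in $1/x$. Fix $\hat\alpha>0$ and set $\alpha=\hat\alpha N$; for each $k$ the integral defining $m_k$ then converges for all sufficiently large $N$. Let $\hat W_1=W_1|_{\alpha=\hat\alpha N}$. Then there is a unique sequence of formal Laurent series $\hat W_{1,l}(x)$, $l\ge 0$, in $1/x$ with real coefficients such that $$\frac1N\hat W_1(x)=\sum_{l=0}^\infty\frac{\hat W_{1,l}(x)}{N^l},$$ in the sense that for each power of $1/x$ the coefficient of the right-hand side is a series converging to the coefficient of the left-hand side for all sufficiently large $N$. These $\hat W_{1,l}$ satisfy,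 as identities of formal Laurent series in $1/x$ with ${}'=d/dx$ taken term by term, $$(1+x^2)(\hat\alpha^2x^2-2\hat\alpha-1)\hat W_{1,0}'(x)+(\hat\alpha^2x^2-\hat\alpha^2-4\hat\alpha-2)\,x\,\hat W_{1,0}(x)=-(\hat\alpha+1)(2\hat\alpha+1),$$ $$(1+x^2)(\hat\alpha^2x^2-2\hat\alpha-1)\hat W_{1,1}'(x)+(\hat\alpha^2x^2-\hat\alpha^2-4\hat\alpha-2)\,x\,\hat W_{1,1}(x)=0,$$ and, for every $l\ge 2$, $$4(1+x^2)(\hat\alpha^2x^2-2\hat\alpha-1)\hat W_{1,l}'(x)+4(\hat\alpha^2x^2-\hat\alpha^2-4\hat\alpha-2)\,x\,\hat W_{1,l}(x)$$ $$=(1+x^2)^3\hat W_{1,l-2}'''(x)+8(1+x^2)^2x\,\hat W_{1,l-2}''(x)+2(1+x^2)(7x^2+3)\hat W_{1,l-2}'(x)+4(1+x^2)\,x\,\hat W_{1,l-2}(x).$$ -/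

import Mathlib

open MeasureTheory Filter

noncomputable section

/-! ### The symmetric Cauchy `β`-ensemble -/

/-- The symmetric Cauchy weight. For real `α` the exponents `α_{β,N} = -β(N-1)/2 - 1 - α` and its
conjugate agree, so `(1 - i x)^{α_{β,N}} (1 + i x)^{α_{β,N}} = (1 + x²)^{α_{β,N}}`. -/
def cauchyWeight (β : ℝ) (N : ℕ) (α x : ℝ) : ℝ :=
  (1 + x ^ 2) ^ (-β * ((N : ℝ) - 1) / 2 - 1 - α)

/-- The unnormalised joint eigenvalue density of the Cauchy `β`-ensemble. -/
def cauchyJoint (β : ℝ) (N : ℕ) (α : ℝ) (x : Fin N → ℝ) : ℝ :=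
  (∏ l, cauchyWeight β N α (x l)) * ∏ j, ∏ k ∈ Finset.Ioi j, |x k - x j| ^ β

/-- The normalisation constant. -/
def cauchyNorm (β : ℝ) (N : ℕ) (α : ℝ) : ℝ :=
  ∫ x : Fin N → ℝ, cauchyJoint β N α x

/-- The eigenvalue density `ρ_{(1)}` of the Cauchy `β`-ensemble (of total mass `N`), obtained by
integrating out all eigenvalues but the first. -/
def cauchyDensity (β : ℝ) : ℕ → ℝ → ℝ → ℝ
  | 0, _, _ => 0
  | n + 1, α, x =>
      ((n + 1 : ℕ) : ℝ) / cauchyNorm β (n + 1) α *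
        ∫ y : Fin n → ℝ, cauchyJoint β (n + 1) α (Fin.cons x y)

/-- The `k`-th moment `m_k = ∫ y^k ρ_{(1)}(y) dy`. The integral converges exactly when
`k < 2α + 1` (for `N ≥ 1`, `α > -1/2`). -/
def cauchyMoment (β : ℝ) (N : ℕ) (α : ℝ) (k : ℕ) : ℝ :=
  ∫ y : ℝ, y ^ k * cauchyDensity β N α y

/-! ### Formal series in `1/x`

A formal Laurent series in `1/x` is an element of Mathlib's `LaurentSeries ℝ`, whose formal
variable plays the role of `1/x`: the coefficient of index `n` is the coefficient of `x⁻ⁿ`. -/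

/-- The element `x`. -/
def xVar : LaurentSeries ℝ := HahnSeries.single (-1) 1

/-- The derivation `d/dx = -(1/x)² d/d(1/x)`, which sends `x⁻ⁿ` to `-n x⁻ⁿ⁻¹`. -/
def ddx (f : LaurentSeries ℝ) : LaurentSeries ℝ :=
  -(HahnSeries.single 2 1 * LaurentSeries.derivative ℝ f)

/-- The formal resolvent `W₁(x) = ∑_{k ≥ 0} m_k / x^{k+1}`. -/
def cauchyResolvent (β : ℝ) (N : ℕ) (α : ℝ) : LaurentSeries ℝ :=
  HahnSeries.single 1 1 * HahnSeries.ofPowerSeries ℤ ℝ (PowerSeries.mk (cauchyMoment β N α))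

/-- `W` is the family of coefficients of the `1/N` expansion of the resolvent,
`(1/N) W₁(x)|_{α = α̂βN/2} = ∑_{l ≥ 0} W_l(x) / N^l`, read coefficientwise in `1/x`: for each power of
`1/x` the identity between the corresponding real coefficients holds for all sufficiently large
`N`. (For a fixed power of `1/x`, the moment in question is a convergent integral for all large
`N`, because `α` grows linearly with `N`.) -/
def IsResolventExpansion (β ahat : ℝ) (W : ℕ → LaurentSeries ℝ) : Prop :=
  ∀ n : ℤ, ∀ᶠ N : ℕ in atTop,
    HasSum (fun l : ℕ => (W l).coeff n / (N : ℝ) ^ l)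
      (1 / (N : ℝ) * (cauchyResolvent β N (ahat * β * N / 2)).coeff n)

/-- The first-order operator
`f ↦ (1 + x²)(α̂²x² - 2α̂ - 1) f' + (α̂²x² - α̂² - 4α̂ - 2) x f`. -/
def firstOrderOp (ahat : ℝ) (f : LaurentSeries ℝ) : LaurentSeries ℝ :=
  let a : LaurentSeries ℝ := HahnSeries.C ahat
  (1 + xVar ^ 2) * (a ^ 2 * xVar ^ 2 - 2 * a - 1) * ddx f
    + (a ^ 2 * xVar ^ 2 - a ^ 2 - 4 * a - 2) * xVar * f

end

/-! Write N = n + 1, c = N + α, σ = 1 + x² and w = σ^(-c). The joint density is a product of weights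
times a squared Vandermonde determinant, so orthogonality gives ρ = K w, where K is the
Christoffel–Darboux kernel of the monic (Romanovski) polynomials orthogonal for w
(`cauchyDensity_two`).

K is a multiple of the Wronskian p'q - q'p with p, q of degrees N and N - 1, and (σKw)' is a
multiple of pq w. By the raising and lowering relations σ d/dx preserves the span of p², pq, q² over
polynomials, so σρ obeys a third-order linear differential equation. Its weak form against x^j
(`kernelPoly_pearson_identity`) is a recurrence between the sums m_k + m_{k+2}
(`cauchyFunctional_recurrence`). Together with the lowest moments it is the differential equation of
W₁, read coefficient by coefficient (`cauchyResolvent_recurrence`); each coefficient needs only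
finitely many convergent moments, hence only large N.

For α = α̂N, division by N³ leaves only the powers 1 and N⁻² (`eventually_scaled_recurrence`).
Solving for the coefficient of highest index shows that each coefficient is analytic in 1/N at 0
(`hasAnalyticExpansion_coeff`), which gives existence; the identity theorem gives uniqueness and
permits comparison of powers of 1/N. The N⁻² part is the third-order operator, applied to the term
two orders earlier. -/

/-! ### Integrals of polynomials against the Cauchy weight -/

open Polynomial in
theorem abs_eval_mul_rpow_le (P : ℝ[X]) {d : ℕ} (hd : P.natDegree ≤ d) (c x : ℝ) :
    ‖P.eval x * (1 + x ^ 2) ^ (-c)‖ ≤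
      (∑ i ∈ Finset.range (d + 1), |P.coeff i|) * (1 + ‖x‖ ^ 2) ^ (-(2 * c - d) / 2) := by
  have h1 : (1 : ℝ) ≤ 1 + x ^ 2 := by nlinarith [sq_nonneg x]
  have h0 : (0 : ℝ) < 1 + x ^ 2 := by linarith
  have hpow : ∀ i ∈ Finset.range (d + 1), |x| ^ i ≤ (1 + x ^ 2) ^ ((d : ℝ) / 2) := by
    intro i hi
    have hi' : (i : ℝ) ≤ d := by exact_mod_cast Nat.lt_succ_iff.mp (Finset.mem_range.mp hi)
    have hx : |x| ≤ (1 + x ^ 2) ^ ((1 : ℝ) / 2) := by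
      rw [← Real.sqrt_eq_rpow]
      exact Real.abs_le_sqrt (by linarith)
    calc |x| ^ i ≤ ((1 + x ^ 2) ^ ((1 : ℝ) / 2)) ^ i := by gcongr
      _ = (1 + x ^ 2) ^ ((i : ℝ) / 2) := by
        rw [← Real.rpow_mul_natCast h0.le]; congr 1; ring
      _ ≤ _ := Real.rpow_le_rpow_of_exponent_le h1 (by linarith)
  have hP : |P.eval x| ≤ (∑ i ∈ Finset.range (d + 1), |P.coeff i|) *
      (1 + x ^ 2) ^ ((d : ℝ) / 2) := by
    rw [eval_eq_sum_range' (Nat.lt_succ_of_le hd), Finset.sum_mul]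
    refine (Finset.abs_sum_le_sum_abs _ _).trans (Finset.sum_le_sum fun i hi => ?_)
    rw [abs_mul, abs_pow]
    exact mul_le_mul_of_nonneg_left (hpow i hi) (abs_nonneg _)
  rw [norm_mul, Real.norm_eq_abs, Real.norm_eq_abs, abs_of_pos (Real.rpow_pos_of_pos h0 _),
    Real.norm_eq_abs, sq_abs]
  calc |P.eval x| * (1 + x ^ 2) ^ (-c) ≤
        ((∑ i ∈ Finset.range (d + 1), |P.coeff i|) * (1 + x ^ 2) ^ ((d : ℝ) / 2)) *
          (1 + x ^ 2) ^ (-c) := by gcongr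
    _ = _ := by
      rw [mul_assoc _ (_ ^ _) (_ ^ _), ← Real.rpow_add h0]; congr 2; ring

open Polynomial in
theorem integrable_eval_mul_rpow (P : ℝ[X]) {d : ℕ} {c : ℝ} (hd : P.natDegree ≤ d)
    (hc : d + 1 < 2 * c) : Integrable fun x : ℝ => P.eval x * (1 + x ^ 2) ^ (-c) := by
  have h : Integrable fun x : ℝ => (1 + ‖x‖ ^ 2) ^ (-(2 * c - d) / 2) :=
    integrable_rpow_neg_one_add_norm_sq (by simp; linarith)
  refine (h.const_mul (∑ i ∈ Finset.range (d + 1), |P.coeff i|)).mono' ?_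
    (Eventually.of_forall fun x => abs_eval_mul_rpow_le P hd c x)
  refine (Continuous.mul P.continuous ?_).aestronglyMeasurable
  exact Continuous.rpow_const (by fun_prop) fun x => Or.inl (by positivity)

open Polynomial in
/-- The linear functional on polynomials whose value at `P` is `∫ P(x) (1 + x²)^(-c) dx`
whenever this integral converges. -/
noncomputable def cauchyFunctional (c : ℝ) : ℝ[X] →ₗ[ℝ] ℝ :=
  Polynomial.lsum fun k => (∫ x : ℝ, x ^ k * (1 + x ^ 2) ^ (-c)) • LinearMap.id

open Polynomial in
theorem cauchyFunctional_eq_integral (P : ℝ[X]) {d : ℕ} {c : ℝ} (hd : P.natDegree ≤ d)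
    (hc : d + 1 < 2 * c) :
    cauchyFunctional c P = ∫ x : ℝ, P.eval x * (1 + x ^ 2) ^ (-c) := by
  simp_rw [eval_eq_sum_range' (Nat.lt_succ_of_le hd), Finset.sum_mul]
  rw [integral_finsetSum]
  · rw [cauchyFunctional, Polynomial.lsum_apply,
      Polynomial.sum_over_range' _ (fun _ => by simp) (d + 1) (Nat.lt_succ_of_le hd)]
    refine Finset.sum_congr rfl fun i _ => ?_
    simp_rw [mul_assoc, integral_const_mul]
    simp [mul_comm]
  · intro i hi
    have := integrable_eval_mul_rpow (C (P.coeff i) * X ^ i) (d := i) (c := c)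
      (natDegree_C_mul_X_pow_le _ _) (by
        have : (i : ℝ) ≤ d := by exact_mod_cast Nat.lt_succ_iff.mp (Finset.mem_range.mp hi)
        linarith)
    simpa using this

-- The polynomial times the weight is the derivative of (1 + x²) P(x) (1 + x²)^(-c). This primitive
-- has polynomial part of degree at most d + 2, and its integrability is what requires d + 3 < 2c.
open Polynomial in
theorem cauchyFunctional_pearson (P : ℝ[X]) {d : ℕ} {c : ℝ} (hd : P.natDegree ≤ d)
    (hc : d + 3 < 2 * c) :
    cauchyFunctional c ((1 + X ^ 2) * derivative P + C (2 - 2 * c) * X * P) = 0 := by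
  have hdP : (derivative P).natDegree ≤ d := (natDegree_derivative_le P).trans (by omega)
  have hσ : (1 + X ^ 2 : ℝ[X]).natDegree ≤ 2 := by compute_degree
  have h1 : ((1 + X ^ 2) * derivative P).natDegree ≤ d + 1 := by
    rcases Nat.eq_zero_or_pos d with h | h
    · have : P.natDegree = 0 := by omega
      simp [derivative_of_natDegree_zero this]
    · refine (natDegree_mul_le_of_le hσ ((natDegree_derivative_le P).trans
        (Nat.sub_le_sub_right hd 1))).trans (by omega)
  have h2 : (C (2 - 2 * c) * X * P).natDegree ≤ d + 1 := by
    refine (natDegree_mul_le_of_le (natDegree_C_mul_le _ _ |>.trans natDegree_X_le) hd).trans (by omega)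
  have h3 := natDegree_add_le_of_degree_le h1 h2
  have h4 : ((1 + X ^ 2) * P).natDegree ≤ d + 2 := by
    refine (natDegree_mul_le_of_le hσ hd).trans (by omega)
  rw [cauchyFunctional_eq_integral _ h3 (by push_cast; linarith)]
  refine integral_eq_zero_of_hasDerivAt_of_integrable (f := fun x : ℝ =>
    ((1 + X ^ 2) * P).eval x * (1 + x ^ 2) ^ (-c)) ?_
    (integrable_eval_mul_rpow _ h3 (by push_cast; linarith))
    (integrable_eval_mul_rpow _ h4 (by push_cast; linarith))
  intro x
  have h0 : (0 : ℝ) < 1 + x ^ 2 := by positivity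
  have hw : HasDerivAt (fun x : ℝ => (1 + x ^ 2) ^ (-c))
      (2 * x * (-c) * (1 + x ^ 2) ^ (-c - 1)) x := by
    have : HasDerivAt (fun x : ℝ => 1 + x ^ 2) (2 * x) x := by
      simpa using (hasDerivAt_pow 2 x).const_add 1
    exact this.rpow_const (Or.inl h0.ne')
  refine ((Polynomial.hasDerivAt _ x).mul hw).congr_deriv ?_
  rw [Real.rpow_sub_one h0.ne']
  simp
  field_simp
  ring

/-! ### Romanovski polynomials -/

/-- The three-term recurrence coefficient of the monic polynomials orthogonal with respect to
`(1 + x²)^(-c)`. -/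
noncomputable def romanovskiCoeff (c : ℝ) (n : ℕ) : ℝ :=
  n * (2 * c - n) / ((2 * c - 2 * n + 1) * (2 * c - 2 * n - 1))

open Polynomial in
/-- The monic polynomials orthogonal with respect to `(1 + x²)^(-c)`. -/
noncomputable def romanovski (c : ℝ) : ℕ → ℝ[X]
  | 0 => 1
  | 1 => X
  | n + 2 => X * romanovski c (n + 1) - C (romanovskiCoeff c (n + 1)) * romanovski c n

namespace romanovski
open Polynomial

theorem natDegree_and_monic (c : ℝ) (n : ℕ) :
    (romanovski c n).natDegree = n ∧ (romanovski c n).Monic := by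
  induction n using Nat.strong_induction_on with
  | _ n ih =>
    match n with
    | 0 => simp [romanovski]
    | 1 => simp [romanovski, monic_X]
    | n + 2 =>
      obtain ⟨h1, h1'⟩ := ih (n + 1) (by omega)
      obtain ⟨h0, -⟩ := ih n (by omega)
      have hX : (X * romanovski c (n + 1)).Monic := monic_X.mul h1'
      have hdX : (X * romanovski c (n + 1)).natDegree = n + 2 := by
        rw [natDegree_X_mul h1'.ne_zero, h1]
      have hlt : (C (romanovskiCoeff c (n + 1)) * romanovski c n).natDegree <
          (X * romanovski c (n + 1)).natDegree := by
        rw [hdX]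
        exact (natDegree_C_mul_le _ _).trans_lt (by omega)
      have hlt' := degree_lt_degree hlt
      rw [romanovski]
      exact ⟨by rw [natDegree_sub_eq_left_of_natDegree_lt hlt, hdX], hX.sub_of_left hlt'⟩

theorem natDegree_eq (c : ℝ) (n : ℕ) : (romanovski c n).natDegree = n :=
  (natDegree_and_monic c n).1

theorem monic (c : ℝ) (n : ℕ) : (romanovski c n).Monic := (natDegree_and_monic c n).2

/-- The lowering and raising relations. -/
theorem structure_relations {c : ℝ} {n : ℕ} (hn : 2 * (n : ℝ) + 1 < 2 * c) :
    (1 + X ^ 2) * derivative (romanovski c (n + 1)) =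
        C ((n : ℝ) + 1) * X * romanovski c (n + 1) +
          C ((n + 1) * (2 * c - (n + 1)) / (2 * c - 2 * n - 1)) * romanovski c n ∧
      (1 + X ^ 2) * derivative (romanovski c n) =
        C (2 * c - (n + 1)) * X * romanovski c n -
          C (2 * c - 2 * n - 1) * romanovski c (n + 1) := by
  induction n with
  | zero =>
    have h : 2 * c - 1 ≠ 0 := by push_cast at hn; linarith
    simp [romanovski, div_self h]
    ring
  | succ n ih =>
    obtain ⟨ih1, ih2⟩ := ih (by push_cast at hn; linarith)
    push_cast at hn
    have e1 : 2 * c - 2 * n - 1 ≠ 0 := by linarith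
    have e3 : 2 * c - 2 * n - 3 ≠ 0 := by linarith
    have e1' : 2 * (c - n) - 1 ≠ 0 := by linarith
    have e3' : 2 * (c - n) - 3 ≠ 0 := by linarith
    set r := romanovskiCoeff c (n + 1) with hr
    have hr' : r = ((n : ℝ) + 1) * (2 * c - (n + 1)) /
        ((2 * c - 2 * n - 1) * (2 * c - 2 * n - 3)) := by
      rw [hr, romanovskiCoeff]; push_cast; ring
    -- Both lowering coefficients are affine in the recurrence coefficient r. Once they are written
    -- so, the induction step is a division-free polynomial identity.
    have hs : ((n : ℝ) + 1) * (2 * c - (n + 1)) / (2 * c - 2 * n - 1) =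
        r * (2 * c - 2 * n - 3) := by
      rw [hr', div_mul_eq_mul_div, mul_div_mul_right _ _ e3]
    have hs' : ((n : ℝ) + 2) * (2 * c - (n + 2)) / (2 * c - 2 * n - 3) =
        1 + r * (2 * c - 2 * n - 1) := by
      rw [hr']; field_simp; ring
    rw [hs] at ih1
    have hs'' : (((n + 1 : ℕ) : ℝ) + 1) * (2 * c - (((n + 1 : ℕ) : ℝ) + 1)) /
        (2 * c - 2 * ((n + 1 : ℕ) : ℝ) - 1) = 1 + r * (2 * c - 2 * n - 1) := by
      rw [← hs']; push_cast; ring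
    rw [hs'', show romanovski c (n + 1 + 1) = X * romanovski c (n + 1) - C r * romanovski c n
      from rfl]
    simp only [derivative_mul, derivative_X, derivative_C, map_add, map_sub,
      map_mul, map_one, map_ofNat, Nat.cast_add, Nat.cast_one, zero_mul] at ih1 ih2 ⊢
    constructor
    · linear_combination X * ih1 - C r * ih2
    · linear_combination ih1

theorem one_add_X_sq_ne_zero : (1 + X ^ 2 : ℝ[X]) ≠ 0 := by
  intro h
  have := congrArg (eval 0) h
  simp at this

theorem differential_equation {c : ℝ} {n : ℕ} (hn : 2 * (n : ℝ) + 1 < 2 * c) :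
    (1 + X ^ 2) * derivative (derivative (romanovski c n)) +
        C (2 - 2 * c) * X * derivative (romanovski c n) =
      C (n * (n + 1 - 2 * c)) * romanovski c n := by
  obtain ⟨h1, h2⟩ := structure_relations hn
  have h2' := congrArg derivative h2
  have e : C (2 * c - 2 * (n : ℝ) - 1) *
      C (((n : ℝ) + 1) * (2 * c - (n + 1)) / (2 * c - 2 * n - 1)) =
      C (((n : ℝ) + 1) * (2 * c - (n + 1))) := by
    rw [← C_mul, mul_div_cancel₀]
    linarith
  -- The differentiated raising relation contains the derivative of the next polynomial; an extra
  -- factor 1 + X² lets the lowering relation eliminate it.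
  apply mul_left_cancel₀ one_add_X_sq_ne_zero
  simp only [derivative_mul, derivative_X, derivative_C,
    derivative_X_pow, derivative_one, derivative_ofNat, map_add, map_sub, map_mul, map_one, Nat.cast_ofNat,
    map_ofNat, zero_mul, Nat.add_one_sub_one, pow_one] at h1 h2 h2' e ⊢
  linear_combination (1 + X ^ 2) * h2' - (2 * C c - 2 * C (n : ℝ) - 1) * h1
    - (C (n : ℝ) + 1) * X * h2 - romanovski c n * e

theorem wronskian_pearson {c : ℝ} {m n : ℕ} (hm : 2 * (m : ℝ) + 1 < 2 * c)
    (hn : 2 * (n : ℝ) + 1 < 2 * c) :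
    (1 + X ^ 2) * derivative (derivative (romanovski c n) * romanovski c m -
          derivative (romanovski c m) * romanovski c n) +
        C (2 - 2 * c) * X * (derivative (romanovski c n) * romanovski c m -
          derivative (romanovski c m) * romanovski c n) =
      C ((n - m) * (n + m + 1 - 2 * c)) * (romanovski c m * romanovski c n) := by
  have h1 := differential_equation hn
  have h2 := differential_equation hm
  simp only [derivative_mul, map_mul, map_sub, map_add, map_one,
    map_ofNat] at h1 h2 ⊢
  linear_combination romanovski c m * h1 - romanovski c n * h2

theorem natDegree_derivative_mul_le (c : ℝ) (m n : ℕ) :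
    (derivative (romanovski c n) * romanovski c m).natDegree ≤ n + m := by
  refine natDegree_mul_le_of_le ((natDegree_derivative_le _).trans ?_) (natDegree_eq c m).le
  rw [natDegree_eq]; omega

/-- The Sturm–Liouville argument: the Wronskian is sent by the Pearson operator to a nonzero
multiple of the product, and the functional kills the image of that operator. -/
theorem orthogonal {c : ℝ} {m n : ℕ} (hmn : m ≠ n) (hm : 2 * (m : ℝ) + 1 < 2 * c)
    (hn : 2 * (n : ℝ) + 1 < 2 * c) (h : (n : ℝ) + m + 3 < 2 * c) :
    cauchyFunctional c (romanovski c m * romanovski c n) = 0 := by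
  have key := cauchyFunctional_pearson (c := c) (d := n + m)
    (derivative (romanovski c n) * romanovski c m - derivative (romanovski c m) * romanovski c n)
    (by
      refine (natDegree_sub_le_of_le (natDegree_derivative_mul_le c m n) (n := n + m) ?_).trans
        (max_self _).le
      rw [add_comm]; exact natDegree_derivative_mul_le c n m) (by push_cast; linarith)
  rw [wronskian_pearson hm hn, ← smul_eq_C_mul, map_smul, smul_eq_mul] at key
  refine (mul_eq_zero.mp key).resolve_left (mul_ne_zero ?_ (by linarith))
  rw [sub_ne_zero]
  exact_mod_cast hmn.symm

theorem X_mul (c : ℝ) (n : ℕ) :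
    X * romanovski c (n + 1) =
      romanovski c (n + 2) + C (romanovskiCoeff c (n + 1)) * romanovski c n := by
  rw [romanovski]; ring

/-- The squared norm of the `n`-th orthogonal polynomial. -/
noncomputable def normSq (c : ℝ) (n : ℕ) : ℝ :=
  cauchyFunctional c (romanovski c n * romanovski c n)

theorem functional_X_mul {c : ℝ} {n : ℕ} (h : 2 * (n : ℝ) + 5 < 2 * c) :
    cauchyFunctional c (X * romanovski c n * romanovski c (n + 1)) = normSq c (n + 1) := by
  cases n with
  | zero => simp [romanovski, normSq]
  | succ n =>
    push_cast at h
    rw [X_mul, add_mul, mul_assoc, ← smul_eq_C_mul, map_add, map_smul,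
      orthogonal (m := n) (n := n + 1 + 1) (by omega) (by linarith) (by push_cast; linarith)
        (by push_cast; linarith)]
    simp [normSq]

/-- The functional at X pₙ pₙ₊₁ is computed twice, with X absorbed into either factor. -/
theorem normSq_succ {c : ℝ} {n : ℕ} (h : 2 * (n : ℝ) + 5 < 2 * c) :
    normSq c (n + 1) = romanovskiCoeff c (n + 1) * normSq c n := by
  rw [← functional_X_mul h, mul_right_comm, X_mul, add_mul, mul_assoc, ← smul_eq_C_mul, map_add,
    map_smul, orthogonal (m := n + 2) (n := n) (by omega) (by push_cast; linarith) (by linarith)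
    (by push_cast; linarith)]
  simp [normSq]

theorem normSq_pos {c : ℝ} {n : ℕ} (h : 2 * (n : ℝ) + 1 < 2 * c) : 0 < normSq c n := by
  have hd : (romanovski c n * romanovski c n).natDegree ≤ n + n :=
    natDegree_mul_le_of_le (natDegree_eq c n).le (natDegree_eq c n).le
  have hI := integrable_eval_mul_rpow _ hd (c := c) (by push_cast; linarith)
  rw [normSq, cauchyFunctional_eq_integral _ hd (by push_cast; linarith)]
  have hcont : Continuous fun x : ℝ =>
      (romanovski c n * romanovski c n).eval x * (1 + x ^ 2) ^ (-c) :=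
    (Polynomial.continuous _).mul
      (Continuous.rpow_const (by fun_prop) fun x => Or.inl (by positivity))
  obtain ⟨x, hx⟩ : ∃ x, (romanovski c n).eval x ≠ 0 := by
    by_contra! hall
    exact (monic c n).ne_zero (Polynomial.funext fun x => by simp [hall x])
  refine integral_pos_of_integrable_nonneg_nonzero (x := x) hcont hI (fun y => ?_) ?_
  · rw [eval_mul]
    exact mul_nonneg (mul_self_nonneg _) (Real.rpow_nonneg (by positivity) _)
  · rw [eval_mul]
    exact mul_ne_zero (mul_self_ne_zero.mpr hx) (Real.rpow_pos_of_pos (by positivity) _).ne'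

theorem christoffel_darboux {c : ℝ} {n : ℕ} (h : 2 * (n : ℝ) + 3 < 2 * c) :
    ∑ j ∈ Finset.range (n + 1), C (normSq c j)⁻¹ * (romanovski c j * romanovski c j) =
      C (normSq c n)⁻¹ * (derivative (romanovski c (n + 1)) * romanovski c n -
        derivative (romanovski c n) * romanovski c (n + 1)) := by
  induction n with
  | zero => simp [romanovski]
  | succ n ih =>
    push_cast at h
    rw [Finset.sum_range_succ, ih (by linarith)]
    have e : C (normSq c (n + 1))⁻¹ * C (romanovskiCoeff c (n + 1)) = C (normSq c n)⁻¹ := by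
      -- Positivity of the norm, factored by `normSq_succ`, shows that the recurrence coefficient is
      -- nonzero.
      have := normSq_pos (c := c) (n := n + 1) (by push_cast; linarith)
      rw [normSq_succ (by linarith)] at this ⊢
      rw [← C_mul]
      congr 1
      have h1 : romanovskiCoeff c (n + 1) ≠ 0 := left_ne_zero_of_mul this.ne'
      have h2 : normSq c n ≠ 0 := right_ne_zero_of_mul this.ne'
      field_simp
    rw [show romanovski c (n + 1 + 1) = X * romanovski c (n + 1) -
      C (romanovskiCoeff c (n + 1)) * romanovski c n from rfl, ← e]
    simp only [derivative_sub, derivative_mul, derivative_X, derivative_C]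
    ring

end romanovski

/-! ### Integrating squared determinants of orthogonal functions -/

section Determinantal

variable {n : ℕ} {φ : Fin n → ℝ → ℝ} {w : ℝ → ℝ}

theorem prod_mul_det_sq_eq_sum (φ : Fin n → ℝ → ℝ) (w : ℝ → ℝ) (x : Fin n → ℝ) :
    (∏ l, w (x l)) * (Matrix.of fun i j => φ j (x i)).det ^ 2 =
      ∑ σ : Equiv.Perm (Fin n), ∑ τ : Equiv.Perm (Fin n),
        ((Equiv.Perm.sign σ : ℤ) : ℝ) * ((Equiv.Perm.sign τ : ℤ) : ℝ) *
          ∏ l, (φ (σ l) (x l) * φ (τ l) (x l) * w (x l)) := by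
  rw [← Matrix.det_transpose, Matrix.det_apply', sq, Finset.sum_mul_sum, Finset.mul_sum]
  refine Finset.sum_congr rfl fun σ _ => ?_
  rw [Finset.mul_sum]
  refine Finset.sum_congr rfl fun τ _ => ?_
  simp only [Finset.prod_mul_distrib, Matrix.transpose_apply, Matrix.of_apply]
  ring

theorem sign_mul_sign_self (σ : Equiv.Perm (Fin n)) :
    ((Equiv.Perm.sign σ : ℤ) : ℝ) * ((Equiv.Perm.sign σ : ℤ) : ℝ) = 1 := by
  rcases Int.units_eq_one_or (Equiv.Perm.sign σ) with h | h <;> simp [h]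

/-- In the double sum over permutations, σ ≠ τ leaves a factor that vanishes by orthogonality; each
of the n! diagonal terms is the product of all the norms. -/
theorem integral_prod_mul_det_sq
    (hI : ∀ a b, Integrable fun x => φ a x * φ b x * w x)
    (ho : ∀ a b, a ≠ b → ∫ x, φ a x * φ b x * w x = 0) :
    ∫ x : Fin n → ℝ, (∏ l, w (x l)) * (Matrix.of fun i j => φ j (x i)).det ^ 2 =
      n.factorial * ∏ j, ∫ x, φ j x * φ j x * w x := by
  have hP : ∀ σ τ : Equiv.Perm (Fin n), Integrable fun x : Fin n → ℝ =>
      ((Equiv.Perm.sign σ : ℤ) : ℝ) * ((Equiv.Perm.sign τ : ℤ) : ℝ) *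
          ∏ l, (φ (σ l) (x l) * φ (τ l) (x l) * w (x l)) := fun σ τ =>
    (Integrable.fintype_prod (f := fun l x => φ (σ l) x * φ (τ l) x * w x)
      fun l => hI _ _).const_mul _
  simp_rw [prod_mul_det_sq_eq_sum]
  rw [integral_finsetSum _ fun σ _ => integrable_finsetSum _ fun τ _ => hP σ τ]
  simp_rw [integral_finsetSum _ fun τ _ => hP _ τ, integral_const_mul]
  have hσ : ∀ σ : Equiv.Perm (Fin n), ∑ τ : Equiv.Perm (Fin n),
      ((Equiv.Perm.sign σ : ℤ) : ℝ) * ((Equiv.Perm.sign τ : ℤ) : ℝ) *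
        ∫ x : Fin n → ℝ, ∏ l, (φ (σ l) (x l) * φ (τ l) (x l) * w (x l)) =
      ∏ j, ∫ x, φ j x * φ j x * w x := by
    intro σ
    rw [Finset.sum_eq_single σ, sign_mul_sign_self, one_mul,
      integral_fintype_prod_volume_eq_prod fun l x => φ (σ l) x * φ (σ l) x * w x]
    · exact Equiv.prod_comp σ fun j => ∫ x, φ j x * φ j x * w x
    · intro τ _ hτ
      obtain ⟨l, hl⟩ : ∃ l, σ l ≠ τ l := by
        by_contra! hall
        exact hτ (Equiv.ext fun l => (hall l).symm)
      rw [integral_fintype_prod_volume_eq_prod fun l x => φ (σ l) x * φ (τ l) x * w x,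
        Finset.prod_eq_zero (Finset.mem_univ l) (ho _ _ hl), mul_zero]
    · simp
  simp [hσ, Fintype.card_perm]

theorem sum_perm_apply_zero (g : Fin (n + 1) → ℝ) :
    ∑ σ : Equiv.Perm (Fin (n + 1)), g (σ 0) = n.factorial * ∑ j, g j := by
  rw [← Equiv.sum_comp Equiv.Perm.decomposeFin.symm, Fintype.sum_prod_type]
  simp [Fintype.card_perm, Finset.mul_sum]

theorem integral_cons_prod_mul_det_sq {φ : Fin (n + 1) → ℝ → ℝ}
    (hI : ∀ a b, Integrable fun x => φ a x * φ b x * w x)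
    (ho : ∀ a b, a ≠ b → ∫ x, φ a x * φ b x * w x = 0)
    (hne : ∀ a, ∫ x, φ a x * φ a x * w x ≠ 0) (x₀ : ℝ) :
    ∫ y : Fin n → ℝ, (∏ l, w ((Fin.cons x₀ y : Fin (n + 1) → ℝ) l)) *
        (Matrix.of fun i j => φ j ((Fin.cons x₀ y : Fin (n + 1) → ℝ) i)).det ^ 2 =
      n.factorial * (∏ j, ∫ x, φ j x * φ j x * w x) *
        ∑ j, φ j x₀ * φ j x₀ * w x₀ / ∫ x, φ j x * φ j x * w x := by
  have hP : ∀ σ τ : Equiv.Perm (Fin (n + 1)), Integrable fun y : Fin n → ℝ =>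
      ((Equiv.Perm.sign σ : ℤ) : ℝ) * ((Equiv.Perm.sign τ : ℤ) : ℝ) *
        ((φ (σ 0) x₀ * φ (τ 0) x₀ * w x₀) *
          ∏ l : Fin n, (φ (σ l.succ) (y l) * φ (τ l.succ) (y l) * w (y l))) := fun σ τ =>
    ((Integrable.fintype_prod (f := fun (l : Fin n) x => φ (σ l.succ) x * φ (τ l.succ) x * w x)
      fun l => hI _ _).const_mul _).const_mul _
  simp_rw [prod_mul_det_sq_eq_sum, Fin.prod_univ_succ (n := n), Fin.cons_zero, Fin.cons_succ]
  rw [integral_finsetSum _ fun σ _ => integrable_finsetSum _ fun τ _ => hP σ τ]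
  simp_rw [integral_finsetSum _ fun τ _ => hP _ τ, integral_const_mul]
  set h : Fin (n + 1) → ℝ := fun j => ∫ x, φ j x * φ j x * w x with hh
  have hσ : ∀ σ : Equiv.Perm (Fin (n + 1)), ∑ τ : Equiv.Perm (Fin (n + 1)),
      ((Equiv.Perm.sign σ : ℤ) : ℝ) * ((Equiv.Perm.sign τ : ℤ) : ℝ) *
        ((φ (σ 0) x₀ * φ (τ 0) x₀ * w x₀) *
        ∫ y : Fin n → ℝ, ∏ l : Fin n, (φ (σ l.succ) (y l) * φ (τ l.succ) (y l) * w (y l))) =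
      (∏ j, h j) * (φ (σ 0) x₀ * φ (σ 0) x₀ * w x₀ / h (σ 0)) := by
    intro σ
    rw [Finset.sum_eq_single σ, sign_mul_sign_self, one_mul,
      integral_fintype_prod_volume_eq_prod
        fun (l : Fin n) x => φ (σ l.succ) x * φ (σ l.succ) x * w x]
    · rw [← Equiv.prod_comp σ h, Fin.prod_univ_succ]
      have h0 : h (σ 0) ≠ 0 := hne (σ 0)
      change _ * ∏ l : Fin n, h (σ l.succ) = _
      generalize h (σ 0) = h₀ at h0 ⊢
      field_simp
    · intro τ _ hτ
      obtain ⟨l, hl⟩ : ∃ l : Fin n, σ l.succ ≠ τ l.succ := by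
        by_contra! hall
        -- With one variable left unintegrated, agreement is known only at successors. A permutation
        -- fixing every successor also fixes 0, so still only σ = τ survives.
        have hmul : (σ⁻¹ * τ) = 1 := by
          have hs : ∀ l : Fin n, (σ⁻¹ * τ) l.succ = l.succ := fun l => by
            rw [Equiv.Perm.mul_apply, ← hall l]; simp
          ext1 l
          refine Fin.cases ?_ hs l
          by_contra hne0
          obtain ⟨k, hk⟩ := Fin.exists_succ_eq.mpr hne0
          have := (σ⁻¹ * τ).injective ((hs k).trans hk)
          exact Fin.succ_ne_zero _ this
        exact hτ (inv_mul_eq_one.mp hmul).symm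
      rw [integral_fintype_prod_volume_eq_prod
          fun (l : Fin n) x => φ (σ l.succ) x * φ (τ l.succ) x * w x,
        Finset.prod_eq_zero (Finset.mem_univ l) (ho _ _ hl), mul_zero, mul_zero]
    · simp
  simp_rw [hσ]
  rw [← Finset.mul_sum, sum_perm_apply_zero fun j => φ j x₀ * φ j x₀ * w x₀ / h j]
  simp only [hh, Fin.prod_univ_succ]
  ring

end Determinantal

/-! ### The eigenvalue density as a kernel -/

section CauchyDensity

open romanovski Polynomial

theorem cauchyWeight_two (N : ℕ) (α x : ℝ) :
    cauchyWeight 2 N α x = (1 + x ^ 2) ^ (-(N + α)) := by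
  rw [cauchyWeight]; congr 1; ring

/-- Any monic family with these degrees gives the Vandermonde determinant, so c is free here; it is
tied to N + α only when orthogonality is used. -/
theorem cauchyJoint_two (c : ℝ) (N : ℕ) (α : ℝ) (x : Fin N → ℝ) :
    cauchyJoint 2 N α x = (∏ l, (1 + x l ^ 2) ^ (-(N + α))) *
      (Matrix.of fun i (j : Fin N) => (romanovski c j).eval (x i)).det ^ 2 := by
  rw [← Matrix.det_eval_matrixOfPolynomials_eq_det_vandermonde x (fun j : Fin N => romanovski c j)
    (fun j => natDegree_eq c j) (fun j => monic c j), Matrix.det_vandermonde, cauchyJoint,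
    ← Finset.prod_pow]
  simp_rw [← Finset.prod_pow, cauchyWeight_two]
  congr 1
  refine Finset.prod_congr rfl fun j _ => Finset.prod_congr (by ext; simp) fun k _ => ?_
  rw [show (2 : ℝ) = ((2 : ℕ) : ℝ) by norm_num, Real.rpow_natCast, sq_abs]

/-- The polynomial part of the eigenvalue density for the weight `(1 + x²)^(-c)`. -/
noncomputable def kernelPoly (c : ℝ) (N : ℕ) : ℝ[X] :=
  ∑ j ∈ Finset.range N, C (normSq c j)⁻¹ * (romanovski c j * romanovski c j)

theorem natDegree_kernelPoly_le (c : ℝ) (n : ℕ) : (kernelPoly c (n + 1)).natDegree ≤ 2 * n := by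
  refine natDegree_sum_le_of_forall_le _ _ fun j hj => (natDegree_C_mul_le _ _).trans ?_
  have := Finset.mem_range.mp hj
  refine (natDegree_mul_le_of_le (natDegree_eq c j).le (natDegree_eq c j).le).trans (by omega)

theorem cauchyDensity_two {n : ℕ} {α : ℝ} (hα : 0 < α) (x : ℝ) :
    cauchyDensity 2 (n + 1) α x =
      (kernelPoly (n + 1 + α) (n + 1)).eval x * (1 + x ^ 2) ^ (-(n + 1 + α : ℝ)) := by
  set c : ℝ := n + 1 + α with hc
  have hle : ∀ a : Fin (n + 1), ((a : ℕ) : ℝ) ≤ n := fun a => by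
    exact_mod_cast Nat.lt_succ_iff.mp a.2
  have hdeg : ∀ a b : Fin (n + 1), (romanovski c a * romanovski c b).natDegree ≤ a + b :=
    fun a b => natDegree_mul_le_of_le (natDegree_eq c a).le (natDegree_eq c b).le
  have hint : ∀ a b : Fin (n + 1),
      cauchyFunctional c (romanovski c a * romanovski c b) =
        ∫ x, (romanovski c a).eval x * (romanovski c b).eval x * (1 + x ^ 2) ^ (-c) :=
    fun a b => by
      rw [cauchyFunctional_eq_integral _ (hdeg a b)
        (by push_cast; linarith [hle a, hle b])]
      simp_rw [eval_mul]
  have hI : ∀ a b : Fin (n + 1), Integrable fun x =>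
      (romanovski c a).eval x * (romanovski c b).eval x * (1 + x ^ 2) ^ (-c) := fun a b => by
    simp_rw [← eval_mul]
    exact integrable_eval_mul_rpow _ (hdeg a b) (by push_cast; linarith [hle a, hle b])
  have ho : ∀ a b : Fin (n + 1), a ≠ b →
      ∫ x, (romanovski c a).eval x * (romanovski c b).eval x * (1 + x ^ 2) ^ (-c) = 0 := by
    intro a b hab
    have hab' : (a : ℕ) ≠ b := fun h => hab (Fin.ext h)
    -- Distinct indices up to n sum to at most 2n - 1, just enough for `orthogonal` to apply for
    -- every α > 0.
    have : ((a : ℕ) : ℝ) + (b : ℕ) + 1 ≤ 2 * n := by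
      have : (a : ℕ) + b + 1 ≤ 2 * n := by omega
      exact_mod_cast this
    rw [← hint, orthogonal hab'] <;> linarith [hle a, hle b]
  have hne : ∀ a : Fin (n + 1),
      ∫ x, (romanovski c a).eval x * (romanovski c a).eval x * (1 + x ^ 2) ^ (-c) ≠ 0 := by
    intro a
    rw [← hint]
    exact (normSq_pos (by linarith [hle a])).ne'
  have hcN : ((n + 1 : ℕ) : ℝ) + α = c := by push_cast; rfl
  rw [cauchyDensity, cauchyNorm]
  simp_rw [cauchyJoint_two c, hcN]
  rw [integral_prod_mul_det_sq (φ := fun (j : Fin (n + 1)) x => (romanovski c j).eval x)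
      (w := fun x => (1 + x ^ 2) ^ (-c)) hI ho,
    integral_cons_prod_mul_det_sq (φ := fun (j : Fin (n + 1)) x => (romanovski c j).eval x)
      (w := fun x => (1 + x ^ 2) ^ (-c)) hI ho hne]
  have hprod := Finset.prod_ne_zero_iff.mpr fun (a : Fin (n + 1)) (_ : a ∈ Finset.univ) => hne a
  rw [← mul_assoc, show ∀ N f : ℝ, N / ((n + 1).factorial * f) * (n.factorial * f) =
    (N * (n.factorial / (n + 1).factorial)) * (f / f) by intros; ring, div_self hprod,
    Nat.factorial_succ]
  have hf : (n.factorial : ℝ) ≠ 0 := by positivity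
  have hn : ((n : ℝ) + 1) ≠ 0 := by positivity
  have : ((n + 1 : ℕ) : ℝ) * (n.factorial / ((n + 1) * n.factorial : ℕ)) * 1 = 1 := by
    push_cast; field_simp
  rw [this, one_mul, kernelPoly, eval_finsetSum, Finset.sum_mul, Finset.sum_range]
  refine Finset.sum_congr rfl fun j _ => ?_
  rw [← hint, eval_mul, eval_mul, eval_C]
  change _ / normSq c j = _
  ring

end CauchyDensity

/-! ### Low moments and the third-order equation of the kernel -/

section KernelMoments

open romanovski Polynomial

theorem natDegree_X_pow_mul_kernelPoly_le (c : ℝ) (n k : ℕ) :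
    (X ^ k * kernelPoly c (n + 1)).natDegree ≤ k + 2 * n :=
  natDegree_mul_le_of_le (natDegree_X_pow_le k) (natDegree_kernelPoly_le c n)

theorem pow_mul_cauchyDensity {n : ℕ} {α : ℝ} (hα : 0 < α) (k : ℕ) (x : ℝ) :
    x ^ k * cauchyDensity 2 (n + 1) α x =
      (X ^ k * kernelPoly (n + 1 + α) (n + 1)).eval x * (1 + x ^ 2) ^ (-(n + 1 + α : ℝ)) := by
  rw [cauchyDensity_two hα, eval_mul, eval_pow, eval_X, mul_assoc]

theorem integrable_pow_mul_cauchyDensity {n : ℕ} {α : ℝ} {k : ℕ} (hα : 0 < α)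
    (hk : (k : ℝ) < 2 * α + 1) :
    Integrable fun y : ℝ => y ^ k * cauchyDensity 2 (n + 1) α y := by
  simp_rw [pow_mul_cauchyDensity hα]
  exact integrable_eval_mul_rpow _ (natDegree_X_pow_mul_kernelPoly_le _ n k)
    (by push_cast; linarith)

theorem cauchyMoment_two {n : ℕ} {α : ℝ} {k : ℕ} (hα : 0 < α) (hk : (k : ℝ) < 2 * α + 1) :
    cauchyMoment 2 (n + 1) α k =
      cauchyFunctional (n + 1 + α) (X ^ k * kernelPoly (n + 1 + α) (n + 1)) := by
  rw [cauchyMoment, cauchyFunctional_eq_integral _ (natDegree_X_pow_mul_kernelPoly_le _ n k)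
    (by push_cast; linarith)]
  simp_rw [pow_mul_cauchyDensity hα]

section Moments

variable {n : ℕ} {α : ℝ}

theorem cauchyFunctional_kernelPoly (hα : 0 < α) :
    cauchyFunctional (n + 1 + α) (kernelPoly (n + 1 + α) (n + 1)) = n + 1 := by
  rw [kernelPoly, map_sum, Finset.sum_congr rfl (g := fun _ => (1 : ℝ))]
  · simp
  · intro j hj
    have hj' : (j : ℝ) ≤ n := by exact_mod_cast Nat.lt_succ_iff.mp (Finset.mem_range.mp hj)
    rw [← smul_eq_C_mul, map_smul]
    exact inv_mul_cancel₀ (normSq_pos (by linarith)).ne'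

/-- Multiplication by X sends each polynomial to a combination of its two neighbours, both
orthogonal to it. -/
theorem cauchyFunctional_X_mul_kernelPoly (hα : 1 < α) :
    cauchyFunctional (n + 1 + α) (X * kernelPoly (n + 1 + α) (n + 1)) = 0 := by
  rw [kernelPoly, Finset.mul_sum, map_sum]
  refine Finset.sum_eq_zero fun j hj => ?_
  have hj' : (j : ℝ) ≤ n := by exact_mod_cast Nat.lt_succ_iff.mp (Finset.mem_range.mp hj)
  rw [mul_left_comm, ← smul_eq_C_mul, map_smul, smul_eq_mul]
  refine mul_eq_zero_of_right _ ?_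
  set c := (n : ℝ) + 1 + α with hc
  cases j with
  | zero =>
    have := orthogonal (c := c) (m := 0) (n := 1) (by simp) (by simp; linarith)
      (by push_cast; linarith) (by push_cast; linarith)
    simpa [romanovski] using this
  | succ j =>
    push_cast at hj'
    rw [← mul_assoc, X_mul, add_mul, mul_assoc, ← smul_eq_C_mul, map_add, map_smul,
      orthogonal (m := j + 2) (n := j + 1) (by omega) (by push_cast; linarith)
        (by push_cast; linarith) (by push_cast; linarith),
      orthogonal (m := j) (n := j + 1) (by omega) (by linarith)
        (by push_cast; linarith) (by push_cast; linarith)]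
    simp

/-- The Christoffel–Darboux formula combined with the lowering and raising relations. -/
theorem one_add_X_sq_mul_kernelPoly (hα : 1 < α) :
    (1 + X ^ 2) * kernelPoly (n + 1 + α) (n + 1) =
      C (normSq (n + 1 + α) n)⁻¹ *
        (C ((n + 1) * (n + 1 + 2 * α) / (2 * α + 1)) *
            (romanovski (n + 1 + α) n * romanovski (n + 1 + α) n) +
          C (2 * α + 1) * (romanovski (n + 1 + α) (n + 1) * romanovski (n + 1 + α) (n + 1)) -
          C (2 * α) * (X * romanovski (n + 1 + α) n * romanovski (n + 1 + α) (n + 1))) := by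
  have hs := structure_relations (c := n + 1 + α) (n := n) (by linarith)
  rw [show (n + 1) * (2 * (n + 1 + α) - (n + 1)) / (2 * (n + 1 + α) - 2 * n - 1) =
      (n + 1) * (n + 1 + 2 * α) / (2 * α + 1) by congr 1 <;> ring,
    show 2 * (n + 1 + α) - 2 * n - 1 = 2 * α + 1 by ring,
    show 2 * (n + 1 + α) - (n + 1) = n + 1 + 2 * α by ring] at hs
  obtain ⟨h1, h2⟩ := hs
  rw [kernelPoly, christoffel_darboux (by linarith)]
  simp only [map_add, map_mul, map_one] at h1 h2 ⊢
  linear_combination C (normSq (n + 1 + α) n)⁻¹ *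
    (romanovski (n + 1 + α) n * h1 - romanovski (n + 1 + α) (n + 1) * h2)

theorem cauchyFunctional_one_add_X_sq_mul_kernelPoly (hα : 2 < α) :
    cauchyFunctional (n + 1 + α) ((1 + X ^ 2) * kernelPoly (n + 1 + α) (n + 1)) =
      2 * α * (n + 1) * (n + 1 + 2 * α) / (4 * α ^ 2 - 1) := by
  have h0 : normSq (n + 1 + α) n ≠ 0 := (normSq_pos (by linarith)).ne'
  have h2 : 2 * α - 1 ≠ 0 := by linarith
  have hr : romanovskiCoeff (n + 1 + α) (n + 1) =
      (n + 1) * (n + 1 + 2 * α) / (4 * α ^ 2 - 1) := by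
    rw [romanovskiCoeff]
    push_cast
    congr 1 <;> ring
  rw [one_add_X_sq_mul_kernelPoly (by linarith), ← smul_eq_C_mul, ← smul_eq_C_mul,
    ← smul_eq_C_mul, ← smul_eq_C_mul, map_smul, map_sub, map_add, map_smul, map_smul, map_smul,
    functional_X_mul (by linarith)]
  change _ • (_ • normSq (n + 1 + α) n + _ • normSq (n + 1 + α) (n + 1) - _) = _
  set r : ℝ := (n + 1) * (n + 1 + 2 * α) / (4 * α ^ 2 - 1) with hr_def
  have hs : (n + 1) * (n + 1 + 2 * α) / (2 * α + 1) = r * (2 * α - 1) := by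
    rw [hr_def, div_mul_eq_mul_div, show 4 * α ^ 2 - 1 = (2 * α + 1) * (2 * α - 1) by ring,
      mul_div_mul_right _ _ h2]
  rw [normSq_succ (by linarith), hr, hs, show 2 * α * (n + 1) * (n + 1 + 2 * α) / (4 * α ^ 2 - 1) =
    2 * α * r by rw [hr_def]; ring]
  simp only [smul_eq_mul]
  field_simp
  ring

/-- The weak form of the third-order equation for σKw, with test polynomial φ. The left side is
annihilated by `cauchyFunctional_pearson`, hence so is the right side; the degree bound on Q tells
for which α. -/
theorem kernelPoly_pearson_identity (hα : 1 < α) (φ : ℝ[X]) :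
    ∃ Q : ℝ[X], Q.natDegree ≤ φ.natDegree + 2 * n + 4 ∧
      (1 + X ^ 2) * derivative Q + C (2 - 2 * (n + 1 + α)) * X * Q =
        (1 + X ^ 2) * kernelPoly (n + 1 + α) (n + 1) *
          (C (4 * α ^ 2) * X * φ - derivative (derivative (derivative (φ * (1 + X ^ 2)) *
            (1 + X ^ 2)) - (C (4 * α ^ 2) * X ^ 2 -
              C (4 * (n + 1) * (n + 1 + 2 * α))) * φ)) := by
  have hs := structure_relations (c := n + 1 + α) (n := n) (by linarith)
  have hG := wronskian_pearson (c := n + 1 + α) (m := n) (n := n + 1) (by linarith)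
    (by push_cast; linarith)
  have hcd := christoffel_darboux (c := n + 1 + α) (n := n) (by linarith)
  change kernelPoly (n + 1 + α) (n + 1) = _ at hcd
  have hdp : (romanovski (n + 1 + α) (n + 1)).natDegree ≤ n + 1 := (natDegree_eq _ _).le
  have hdq : (romanovski (n + 1 + α) n).natDegree ≤ n := (natDegree_eq _ _).le
  have hdK := natDegree_kernelPoly_le (n + 1 + α) n
  rw [show 2 * (n + 1 + α) - 2 * n - 1 = 2 * α + 1 by ring,
    show 2 * (n + 1 + α) - (n + 1) = n + 1 + 2 * α by ring] at hs
  set s : ℝ := (n + 1) * (n + 1 + 2 * α) / (2 * α + 1) with hs_def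
  have e : C s * (2 * C α + 1) = (C (n : ℝ) + 1) * (C (n : ℝ) + 1 + 2 * C α) := by
    have : s * (2 * α + 1) = (n + 1) * (n + 1 + 2 * α) := by
      rw [hs_def, div_mul_cancel₀]; linarith
    simpa only [map_mul, map_add, map_one, map_ofNat] using congrArg C this
  set p := romanovski (n + 1 + α) (n + 1)
  set q := romanovski (n + 1 + α) n
  set K := kernelPoly (n + 1 + α) (n + 1)
  set h := normSq (n + 1 + α) n
  obtain ⟨h1, h2⟩ := hs
  rw [show (((n + 1 : ℕ) : ℝ) - n) * ((n + 1 : ℕ) + n + 1 - 2 * (n + 1 + α)) = -(2 * α) by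
    push_cast; ring] at hG
  -- Q collects the boundary terms of repeated integration by parts: the K term moves a derivative
  -- onto σKw, giving pq; the pq term moves one onto pq, giving p² and q²; the remaining term
  -- removes these.
  refine ⟨C h⁻¹ * C (2 * α) * (φ * (C s * (q * q) - C (2 * α + 1) * (p * p)) -
    derivative (φ * (1 + X ^ 2)) * (p * q)) - (derivative (derivative (φ * (1 + X ^ 2)) *
            (1 + X ^ 2)) - (C (4 * α ^ 2) * X ^ 2 -
              C (4 * (n + 1) * (n + 1 + 2 * α))) * φ) * K, ?_, ?_⟩
  · have hσ : (1 + X ^ 2 : ℝ[X]).natDegree ≤ 2 := by compute_degree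
    have hκ : (C (4 * α ^ 2) * X ^ 2 - C (4 * (n + 1) * (n + 1 + 2 * α)) : ℝ[X]).natDegree ≤ 2 := by
      compute_degree
    set d := φ.natDegree with hd
    have hψ₁ : (derivative (φ * (1 + X ^ 2))).natDegree ≤ d + 2 :=
      (natDegree_derivative_le _).trans
        ((Nat.sub_le _ _).trans (natDegree_mul_le_of_le hd.ge hσ))
    have hψ₂ : (derivative (derivative (φ * (1 + X ^ 2)) * (1 + X ^ 2))).natDegree ≤ d + 4 :=
      (natDegree_derivative_le _).trans
        ((Nat.sub_le _ _).trans (natDegree_mul_le_of_le (m := d + 2) (n := 2) hψ₁ hσ))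
    have hpp := natDegree_mul_le_of_le hdp hdp
    have hqq := natDegree_mul_le_of_le hdq hdq
    have hpq := natDegree_mul_le_of_le hdp hdq
    have hE : (C s * (q * q) - C (2 * α + 1) * (p * p)).natDegree ≤ 2 * n + 2 :=
      (natDegree_sub_le_of_le ((natDegree_C_mul_le _ _).trans hqq)
        ((natDegree_C_mul_le _ _).trans hpp)).trans (by omega)
    have h₁ := natDegree_mul_le_of_le hd.ge hE
    have h₂ := natDegree_mul_le_of_le hψ₁ hpq
    have h₃ := natDegree_mul_le_of_le
      (natDegree_sub_le_of_le hψ₂ (natDegree_mul_le_of_le hκ hd.ge)) hdK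
    rw [← C_mul]
    refine (natDegree_sub_le_of_le ((natDegree_C_mul_le _ _).trans
      (natDegree_sub_le_of_le h₁ h₂)) h₃).trans ?_
    omega
  · rw [hcd]
    set G := derivative p * q - derivative q * p with hGdef
    have hσG : (1 + X ^ 2) * G = C s * (q * q) + C (2 * α + 1) * (p * p) -
      C (2 * α) * X * (p * q) := by
      simp only [map_add, map_mul, map_one, map_ofNat] at h1 h2 ⊢
      linear_combination q * h1 - p * h2
    clear_value G
    set φ' := derivative φ with hφ'
    set φ'' := derivative φ' with hφ''
    set φ''' := derivative φ'' with hφ'''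
    simp only [map_add, map_mul, map_sub, map_one, map_ofNat, map_neg, map_pow, derivative_C,
      derivative_X, derivative_X_pow, derivative_mul, derivative_one, derivative_ofNat,
      derivative_zero, Nat.cast_ofNat, Nat.add_one_sub_one, pow_one, zero_mul, ← hφ', ← hφ'', ← hφ''']
      at h1 h2 hG hσG e ⊢
    linear_combination C h⁻¹ * (
      (-(φ'' * (1 + X ^ 2) + φ' * (2 * X) + (φ' * (2 * X) + φ * 2)) * (1 + X ^ 2)
        - (φ' * (1 + X ^ 2) + φ * (2 * X)) * (2 * X)
        + (4 * C α ^ 2 * X ^ 2 - 4 * (C (n : ℝ) + 1) * (C (n : ℝ) + 1 + 2 * C α)) * φ) * hG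
      + 2 * C α * (2 * φ * C s * q * h2 - 2 * φ * (2 * C α + 1) * p * h1
        - (φ' * (1 + X ^ 2) + φ * (2 * X)) * (q * h1 + p * h2))
      - 8 * C α * φ * p * q * e - 4 * C α ^ 2 * X * φ * hσG)

end Moments

end KernelMoments

/-! ### Recurrences for the moments and the resolvent -/

section MomentRecurrence

open romanovski Polynomial

/-- The truncated exponents j - 1 and j - 3 are harmless: where truncation occurs, the coefficient j
or j(j - 1)(j - 2) is zero. -/
theorem derivative_X_pow_identity (a b : ℝ) (j : ℕ) :
    derivative (derivative (derivative (X ^ j * (1 + X ^ 2)) * (1 + X ^ 2)) -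
        (C a * X ^ 2 - C b) * X ^ j) =
      C ((j + 2) * ((j + 2) * (j + 3) - a)) * X ^ (j + 1) +
        C (j * (2 * (j + 1) ^ 2 + b)) * X ^ (j - 1) +
        C ((j : ℝ) * (j - 1) * (j - 2)) * X ^ (j - 3) := by
  rcases j with _ | _ | _ | j
  all_goals
    simp only [derivative_mul, derivative_X_pow, derivative_X,
      derivative_C, derivative_one, derivative_ofNat, derivative_natCast,
      map_add, map_mul, map_sub, map_one, map_ofNat, map_pow, map_zero, map_natCast, Nat.cast_add,
      Nat.cast_one, Nat.cast_ofNat, Nat.cast_zero, Nat.add_one_sub_one, pow_zero, pow_one, zero_add,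
      Nat.reduceAdd, Nat.reduceSub, Nat.sub_self, zero_mul, mul_zero, mul_one,
      add_zero, one_mul]
    try rw [show j + 1 + 1 + 1 - 3 = j by omega]
    try ring

section Moments

variable {n : ℕ} {α : ℝ}

theorem cauchyFunctional_recurrence {j : ℕ} (hα : (j : ℝ) + 5 < 2 * α) {μ : ℕ → ℝ}
    (hμ : ∀ k, μ k = cauchyFunctional (n + 1 + α) (X ^ k * kernelPoly (n + 1 + α) (n + 1))) :
    ((j : ℝ) + 3) * ((j + 2) ^ 2 - 4 * α ^ 2) * (μ (j + 1) + μ (j + 3)) +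
      j * (2 * (j + 1) ^ 2 + 4 * (n + 1) * (n + 1 + 2 * α)) * (μ (j - 1) + μ (j - 1 + 2)) +
      j * (j - 1) * (j - 2) * (μ (j - 3) + μ (j - 3 + 2)) = 0 := by
  obtain ⟨Q, hQd, hQ⟩ := kernelPoly_pearson_identity (n := n) (α := α)
    (by linarith [(Nat.cast_nonneg j : (0 : ℝ) ≤ j)]) (X ^ j)
  rw [natDegree_X_pow] at hQd
  -- Degree j + 2n + 4 requires j + 2n + 7 < 2c = 2n + 2 + 2α, which is the hypothesis on α.
  have hL := cauchyFunctional_pearson Q hQd (c := n + 1 + α) (by push_cast; linarith)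
  rw [hQ, derivative_X_pow_identity] at hL
  set K := kernelPoly (n + 1 + α) (n + 1)
  have hpoly : (1 + X ^ 2) * K * (C (4 * α ^ 2) * X * X ^ j -
      (C (((j : ℝ) + 2) * ((j + 2) * (j + 3) - 4 * α ^ 2)) * X ^ (j + 1) +
        C ((j : ℝ) * (2 * (j + 1) ^ 2 + 4 * (n + 1) * (n + 1 + 2 * α))) * X ^ (j - 1) +
        C ((j : ℝ) * (j - 1) * (j - 2)) * X ^ (j - 3))) =
      C (-(((j : ℝ) + 3) * ((j + 2) ^ 2 - 4 * α ^ 2))) * (X ^ (j + 1) * K + X ^ (j + 3) * K) +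
      C (-((j : ℝ) * (2 * (j + 1) ^ 2 + 4 * (n + 1) * (n + 1 + 2 * α)))) *
        (X ^ (j - 1) * K + X ^ (j - 1 + 2) * K) +
      C (-((j : ℝ) * (j - 1) * (j - 2))) * (X ^ (j - 3) * K + X ^ (j - 3 + 2) * K) := by
    simp only [map_add, map_mul, map_sub, map_one, map_ofNat, map_pow, map_neg]
    ring
  rw [hpoly] at hL
  simp only [← smul_eq_C_mul, map_add, map_smul, ← hμ, smul_eq_mul] at hL
  linarith

theorem cauchyResolvent_coeff_of_nonpos (β : ℝ) (N : ℕ) (α : ℝ) {i : ℤ} (hi : i ≤ 0) :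
    (cauchyResolvent β N α).coeff i = 0 := by
  rw [cauchyResolvent, HahnSeries.coeff_single_mul, one_mul, PowerSeries.coeff_coe,
    if_pos (by omega)]

theorem cauchyResolvent_coeff_add_one (β : ℝ) (N : ℕ) (α : ℝ) (k : ℕ) :
    (cauchyResolvent β N α).coeff (k + 1) = cauchyMoment β N α k := by
  rw [cauchyResolvent, HahnSeries.coeff_single_mul, one_mul, add_sub_cancel_right,
    HahnSeries.ofPowerSeries_apply_coeff, PowerSeries.coeff_mk]

theorem cauchyResolvent_coeff_one (n : ℕ) {α : ℝ} (hα : 0 < α) :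
    (cauchyResolvent 2 (n + 1) α).coeff 1 = n + 1 := by
  have := cauchyResolvent_coeff_add_one 2 (n + 1) α 0
  rw [cauchyMoment_two hα (by push_cast; linarith), pow_zero, one_mul,
    cauchyFunctional_kernelPoly hα] at this
  simpa using this

/-- The moment recurrence, which is the coefficient of `x⁻ⁱ` in the differential equation of the
resolvent. -/
theorem cauchyResolvent_recurrence {i : ℤ} (hα : |(i : ℝ)| + 5 < 2 * α) {a : ℤ → ℝ}
    (ha : a = (cauchyResolvent 2 (n + 1) α).coeff) :
    ((i : ℝ) + 2) * ((i + 1) ^ 2 - 4 * α ^ 2) * (a (i + 1) + a (i + 3)) +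
      (i - 1) * (2 * i ^ 2 + 4 * (n + 1) * (n + 1 + 2 * α)) * (a (i - 1) + a (i + 1)) +
      (i - 1) * (i - 2) * (i - 3) * (a (i - 3) + a (i - 1)) =
      if i = 0 then -(4 * (α + (n + 1)) * (2 * α + (n + 1)) * (n + 1)) else 0 := by
  have hα0 : 5 < 2 * α := by linarith [abs_nonneg (i : ℝ)]
  have hz : ∀ k : ℤ, k ≤ 0 → a k = 0 := fun k hk => by
    rw [ha, cauchyResolvent_coeff_of_nonpos _ _ _ hk]
  set μ : ℕ → ℝ := fun k =>
    cauchyFunctional (n + 1 + α) (X ^ k * kernelPoly (n + 1 + α) (n + 1)) with hμ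
  have hm : ∀ k : ℕ, (k : ℝ) < 2 * α + 1 → a (k + 1) = μ k := fun k hk => by
    rw [ha, cauchyResolvent_coeff_add_one, cauchyMoment_two (by linarith) hk]
  have h0 : a 1 = n + 1 := ha ▸ cauchyResolvent_coeff_one n (by linarith)
  have h1 : a 2 = 0 := by
    have := hm 1 (by push_cast; linarith)
    simpa [hμ, cauchyFunctional_X_mul_kernelPoly (n := n) (α := α) (by linarith)] using this
  rcases lt_or_ge 0 i with hi | hi
  · obtain ⟨j, rfl⟩ : ∃ j : ℕ, i = j + 1 := ⟨(i - 1).toNat, by omega⟩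
    push_cast at hα ⊢
    rw [abs_of_nonneg (by positivity)] at hα
    have hrec := cauchyFunctional_recurrence (n := n) (j := j) (α := α) (μ := μ) (by linarith)
      fun k => rfl
    rw [if_neg (by omega)]
    have e1 : a (j + 1 + 1) = μ (j + 1) := by
      rw [← hm _ (by push_cast; linarith)]; push_cast; ring_nf
    have e3 : a (j + 1 + 3) = μ (j + 3) := by
      rw [← hm _ (by push_cast; linarith)]; push_cast; ring_nf
    rw [e1, e3]
    -- Small j are separated because `j - 1` and `j - 3` truncate in the moment recurrence, whereas
    -- the integer indices of `a` do not.
    rcases j with _ | _ | _ | j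
    · push_cast at hrec ⊢
      simp only [zero_add, zero_mul, add_zero] at hrec ⊢
      linear_combination hrec
    · have e0 : a ((1 : ℕ) + 1 - 1) = μ 0 := by
        rw [← hm 0 (by push_cast; linarith)]; norm_num
      simp only [zero_add] at hrec ⊢
      rw [e0]
      norm_num at hrec ⊢
      linear_combination hrec
    · have e0 : a (((0 + 1 + 1 : ℕ) : ℤ) + 1 - 1) = μ 1 := by
        rw [← hm 1 (by push_cast; linarith)]; norm_num
      rw [e0]
      norm_num at hrec ⊢
      linear_combination hrec
    · have e0 : a (((j + 1 + 1 + 1 : ℕ) : ℤ) + 1 - 1) = μ (j + 2) := by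
        rw [← hm _ (by push_cast at hα ⊢; linarith)]; push_cast; ring_nf
      have e4 : a (((j + 1 + 1 + 1 : ℕ) : ℤ) + 1 - 3) = μ j := by
        rw [← hm _ (by push_cast at hα ⊢; linarith)]; push_cast; ring_nf
      rw [e0, e4]
      rw [show j + 1 + 1 + 1 - 1 = j + 2 by omega, show j + 1 + 1 + 1 - 3 = j by omega] at hrec
      push_cast at hrec ⊢
      linear_combination hrec
  -- No test power x^j covers i ≤ 0. At i = 0 the values of m₀ and m₀ + m₂ produce the source term;
  -- at i = -1 the moment m₁ vanishes; at i = -2 the factor i + 2 kills m₀; below that every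
  -- coefficient is zero.
  · obtain rfl | rfl | rfl | hi : i = 0 ∨ i = -1 ∨ i = -2 ∨ i ≤ -3 := by omega
    · have h13 : a 1 + a 3 = 2 * α * (n + 1) * (n + 1 + 2 * α) / (4 * α ^ 2 - 1) := by
        have e1 := hm 0 (by push_cast; linarith)
        have e3 := hm 2 (by push_cast; linarith)
        rw [← cauchyFunctional_one_add_X_sq_mul_kernelPoly (by linarith), add_mul, map_add]
        norm_num [hμ] at e1 e3
        rw [e1, e3, one_mul]
      have hne : 4 * α ^ 2 - 1 ≠ 0 := by nlinarith
      rw [eq_div_iff hne] at h13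
      rw [zero_add, zero_add, h0] at *
      rw [hz (0 - 1) (by omega), hz (0 - 3) (by omega), if_pos rfl]
      push_cast
      linear_combination (-2) * h13
    · norm_num
      rw [h1, hz 0 le_rfl, hz (-2) (by omega), hz (-4) (by omega)]
      ring
    · norm_num
      rw [hz (-1) (by omega), hz (-3) (by omega), hz (-5) (by omega)]
      ring
    · rw [hz _ (by omega), hz _ (by omega), hz _ (by omega), hz _ (by omega), if_neg (by omega)]
      ring

end Moments

end MomentRecurrence

/-! ### Series in 1/N -/

theorem hasSum_of_forall_eq {f g : ℕ → ℝ} {s : ℝ} (h : HasSum f s) (hfg : ∀ l, f l = g l) :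
    HasSum g s :=
  (funext hfg : f = g) ▸ h

open Topology in
theorem tendsto_one_div_natCast_punctured :
    Tendsto (fun N : ℕ => 1 / (N : ℝ)) atTop (𝓝[≠] 0) := by
  refine tendsto_nhdsWithin_iff.mpr ⟨tendsto_one_div_atTop_nhds_zero_nat, ?_⟩
  filter_upwards [eventually_gt_atTop 0] with N hN
  have : (0 : ℝ) < N := by exact_mod_cast hN
  exact (one_div_pos.mpr this).ne'

/-- A series in `1/N` which vanishes for all large `N` has vanishing coefficients. -/
theorem eq_zero_of_eventually_hasSum_div_pow {a : ℕ → ℝ}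
    (h : ∀ᶠ N : ℕ in atTop, HasSum (fun l => a l / (N : ℝ) ^ l) 0) (l : ℕ) : a l = 0 := by
  obtain ⟨M, hM, hM0⟩ := (h.and (eventually_gt_atTop 0)).exists
  have hM0' : (0 : ℝ) < M := by exact_mod_cast hM0
  -- Convergence at the single point 1/M bounds the coefficients by B Mˡ, so the power series
  -- converges for |z| < 1/M.
  obtain ⟨B, hB⟩ :=
    (Metric.isBounded_range_of_tendsto _ hM.summable.tendsto_atTop_zero).exists_norm_le
  have hf : HasFPowerSeriesAt (fun z : ℝ => ∑' l, z ^ l • a l)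
      (FormalMultilinearSeries.ofScalars ℝ a) 0 := by
    rw [hasFPowerSeriesAt_iff]
    filter_upwards [Metric.ball_mem_nhds (0 : ℝ) (one_div_pos.mpr hM0')] with z hz
    simp only [zero_add, FormalMultilinearSeries.coeff_ofScalars]
    refine Summable.hasSum ?_
    have hz' : |z| * M < 1 := by
      rw [mem_ball_zero_iff, Real.norm_eq_abs, lt_div_iff₀ hM0'] at hz
      exact hz
    refine Summable.of_norm_bounded ((summable_geometric_of_lt_one (by positivity) hz').mul_left B)
      fun l => ?_
    have hl := hB _ ⟨l, rfl⟩
    rw [norm_div, norm_pow, Real.norm_natCast, div_le_iff₀ (by positivity)] at hl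
    calc ‖z ^ l • a l‖ = |z| ^ l * ‖a l‖ := by rw [norm_smul, norm_pow, Real.norm_eq_abs]
      _ ≤ |z| ^ l * (B * M ^ l) := by gcongr
      _ = B * (|z| * M) ^ l := by rw [mul_pow]; ring
  -- The identity theorem applies: the sum vanishes at the points 1/N, which accumulate at 0.
  have hzero : ∀ᶠ z in nhds (0 : ℝ), (fun z : ℝ => ∑' l, z ^ l • a l) z = (fun _ => 0) z := by
    rw [← hf.analyticAt.frequently_eq_iff_eventually_eq analyticAt_const]
    refine tendsto_one_div_natCast_punctured.frequently (Eventually.frequently ?_)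
    filter_upwards [h] with N hN
    rw [← hN.tsum_eq]
    refine tsum_congr fun l => ?_
    rw [one_div, inv_pow, smul_eq_mul, div_eq_inv_mul]
  rw [← FormalMultilinearSeries.coeff_ofScalars (𝕜 := ℝ) (p := a) (n := l),
    hf.eq_zero_of_eventually hzero]
  rfl

/-- The sequence `g` agrees for all large `N` with a function of `1/N` analytic at `0`. -/
def HasAnalyticExpansion (g : ℕ → ℝ) : Prop :=
  ∃ f : ℝ → ℝ, AnalyticAt ℝ f 0 ∧ ∀ᶠ N : ℕ in atTop, g N = f (1 / N)

namespace HasAnalyticExpansion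

theorem of_analyticAt {f : ℝ → ℝ} (hf : AnalyticAt ℝ f 0) :
    HasAnalyticExpansion fun N => f (1 / N) :=
  ⟨f, hf, Eventually.of_forall fun _ => rfl⟩

theorem congr {g g' : ℕ → ℝ} (hg : HasAnalyticExpansion g) (h : ∀ᶠ N in atTop, g' N = g N) :
    HasAnalyticExpansion g' := by
  obtain ⟨f, hf, hfg⟩ := hg
  exact ⟨f, hf, by filter_upwards [h, hfg] with N h1 h2 using h1.trans h2⟩

theorem add {g g' : ℕ → ℝ} (hg : HasAnalyticExpansion g) (hg' : HasAnalyticExpansion g') :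
    HasAnalyticExpansion fun N => g N + g' N := by
  obtain ⟨f, hf, hfg⟩ := hg
  obtain ⟨f', hf', hfg'⟩ := hg'
  exact ⟨fun z => f z + f' z, hf.add hf', by
    filter_upwards [hfg, hfg'] with N h1 h2 using by rw [h1, h2]⟩

theorem mul {g g' : ℕ → ℝ} (hg : HasAnalyticExpansion g) (hg' : HasAnalyticExpansion g') :
    HasAnalyticExpansion fun N => g N * g' N := by
  obtain ⟨f, hf, hfg⟩ := hg
  obtain ⟨f', hf', hfg'⟩ := hg'
  exact ⟨fun z => f z * f' z, hf.mul hf', by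
    filter_upwards [hfg, hfg'] with N h1 h2 using by rw [h1, h2]⟩

theorem exists_hasSum {g : ℕ → ℝ} (hg : HasAnalyticExpansion g) :
    ∃ a : ℕ → ℝ, ∀ᶠ N : ℕ in atTop, HasSum (fun l => a l / (N : ℝ) ^ l) (g N) := by
  obtain ⟨f, ⟨p, hp⟩, hfg⟩ := hg
  rw [hasFPowerSeriesAt_iff] at hp
  refine ⟨p.coeff, ?_⟩
  filter_upwards [hfg, tendsto_one_div_atTop_nhds_zero_nat.eventually hp] with N h1 h2
  rw [h1]
  rw [zero_add] at h2
  refine hasSum_of_forall_eq h2 fun l => ?_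
  rw [one_div, inv_pow, smul_eq_mul, div_eq_inv_mul]

end HasAnalyticExpansion

/-! ### Coefficients of the differential operators -/

theorem ddx_coeff (f : LaurentSeries ℝ) (i : ℤ) :
    (ddx f).coeff i = -((i : ℝ) - 1) * f.coeff (i - 1) := by
  rw [ddx, HahnSeries.coeff_neg, HahnSeries.coeff_single_mul, one_mul,
    LaurentSeries.derivative_apply, LaurentSeries.hasseDeriv_coeff]
  rw [show i - 2 + ((1 : ℕ) : ℤ) = i - 1 by push_cast; ring, Ring.choose_one_right, zsmul_eq_mul]
  push_cast; ring

theorem xVar_pow_mul_coeff (k : ℕ) (f : LaurentSeries ℝ) (i : ℤ) :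
    (xVar ^ k * f).coeff i = f.coeff (i + k) := by
  rw [xVar, HahnSeries.single_pow, HahnSeries.coeff_single_mul, one_pow, one_mul]
  congr 1
  simp

theorem C_mul_coeff (r : ℝ) (f : LaurentSeries ℝ) (i : ℤ) :
    (HahnSeries.C r * f).coeff i = r * f.coeff i := by
  rw [HahnSeries.C_mul_eq_smul, HahnSeries.coeff_smul, smul_eq_mul]

theorem firstOrderOp_coeff (a : ℝ) (f : LaurentSeries ℝ) (i : ℤ) :
    (firstOrderOp a f).coeff i =
      -a ^ 2 * (i + 2) * (f.coeff (i + 1) + f.coeff (i + 3)) +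
        (i - 1) * (2 * a + 1) * (f.coeff (i - 1) + f.coeff (i + 1)) := by
  have h : firstOrderOp a f =
      HahnSeries.C (a ^ 2) * (xVar ^ 4 * ddx f) +
        HahnSeries.C (a ^ 2 - 2 * a - 1) * (xVar ^ 2 * ddx f) +
        HahnSeries.C (-(2 * a + 1)) * (xVar ^ 0 * ddx f) +
        HahnSeries.C (a ^ 2) * (xVar ^ 3 * f) +
        HahnSeries.C (-(a ^ 2 + 4 * a + 2)) * (xVar ^ 1 * f) := by
    simp only [firstOrderOp, map_add, map_sub, map_neg, map_mul, map_pow, map_one, map_ofNat]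
    ring
  rw [h]
  simp only [HahnSeries.coeff_add, C_mul_coeff, xVar_pow_mul_coeff, ddx_coeff]
  push_cast
  rw [show i + 4 - 1 = i + 3 by ring, show i + 2 - 1 = i + 1 by ring, add_zero]
  ring_nf

/-- The third-order operator on the right-hand side of the recursion for the coefficients of the
`1/N` expansion. -/
noncomputable def thirdOrderOp (f : LaurentSeries ℝ) : LaurentSeries ℝ :=
  (1 + xVar ^ 2) ^ 3 * ddx (ddx (ddx f)) + 8 * (1 + xVar ^ 2) ^ 2 * xVar * ddx (ddx f)
    + 2 * (1 + xVar ^ 2) * (7 * xVar ^ 2 + 3) * ddx f + 4 * (1 + xVar ^ 2) * xVar * f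

/-- Up to sign this is the N⁻² bracket of `eventually_scaled_recurrence`, just as
`firstOrderOp_coeff` gives its leading bracket. -/
theorem thirdOrderOp_coeff (f : LaurentSeries ℝ) (i : ℤ) :
    (thirdOrderOp f).coeff i =
      -((i + 2) * (i + 1) ^ 2 * (f.coeff (i + 1) + f.coeff (i + 3)) +
        (i - 1) * (2 * i ^ 2) * (f.coeff (i - 1) + f.coeff (i + 1)) +
        (i - 1) * (i - 2) * (i - 3) * (f.coeff (i - 3) + f.coeff (i - 1))) := by
  have h : thirdOrderOp f =
      xVar ^ 6 * ddx (ddx (ddx f)) + HahnSeries.C 3 * (xVar ^ 4 * ddx (ddx (ddx f))) +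
        HahnSeries.C 3 * (xVar ^ 2 * ddx (ddx (ddx f))) + xVar ^ 0 * ddx (ddx (ddx f)) +
        HahnSeries.C 8 * (xVar ^ 5 * ddx (ddx f)) + HahnSeries.C 16 * (xVar ^ 3 * ddx (ddx f)) +
        HahnSeries.C 8 * (xVar ^ 1 * ddx (ddx f)) + HahnSeries.C 14 * (xVar ^ 4 * ddx f) +
        HahnSeries.C 20 * (xVar ^ 2 * ddx f) + HahnSeries.C 6 * (xVar ^ 0 * ddx f) +
        HahnSeries.C 4 * (xVar ^ 3 * f) + HahnSeries.C 4 * (xVar ^ 1 * f) := by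
    simp only [thirdOrderOp, map_ofNat]
    ring
  rw [h]
  simp only [HahnSeries.coeff_add, C_mul_coeff, xVar_pow_mul_coeff, ddx_coeff]
  push_cast
  ring_nf

/-! ### Existence, uniqueness and recursion of the 1/N expansion -/

/-- The recurrence for the coefficients of `(1/N) W₁`. -/
theorem eventually_scaled_recurrence {ahat : ℝ} (hahat : 0 < ahat) {b : ℕ → ℤ → ℝ}
    (hb : ∀ N i, b N i = 1 / (N : ℝ) * (cauchyResolvent 2 N (ahat * 2 * N / 2)).coeff i) (i : ℤ) :
    ∀ᶠ N : ℕ in atTop,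
      4 * (-ahat ^ 2 * (i + 2) * (b N (i + 1) + b N (i + 3)) +
          (i - 1) * (2 * ahat + 1) * (b N (i - 1) + b N (i + 1))) +
        ((i + 2) * (i + 1) ^ 2 * (b N (i + 1) + b N (i + 3)) +
          (i - 1) * (2 * i ^ 2) * (b N (i - 1) + b N (i + 1)) +
          (i - 1) * (i - 2) * (i - 3) * (b N (i - 3) + b N (i - 1))) * (1 / (N : ℝ)) ^ 2 =
      if i = 0 then -(4 * ((ahat + 1) * (2 * ahat + 1))) else 0 := by
  have hlim : Tendsto (fun N : ℕ => 2 * ahat * (N : ℝ)) atTop atTop :=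
    tendsto_natCast_atTop_atTop.const_mul_atTop (by linarith)
  filter_upwards [hlim.eventually_gt_atTop (|(i : ℝ)| + 5), eventually_gt_atTop 0] with N hN hN0
  obtain ⟨n, rfl⟩ : ∃ n, N = n + 1 := ⟨N - 1, by omega⟩
  have hrec := cauchyResolvent_recurrence (n := n) (α := ahat * 2 * (n + 1 : ℕ) / 2) (i := i)
    (by linarith) rfl
  have hn : ((n : ℝ) + 1) ≠ 0 := by positivity
  have ha : ∀ j, (cauchyResolvent 2 (n + 1) (ahat * 2 * (n + 1 : ℕ) / 2)).coeff j =
      (n + 1) * b (n + 1) j := fun j => by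
    rw [hb]; push_cast; field_simp
  simp only [ha] at hrec
  have h3 : ((n : ℝ) + 1) ^ 3 ≠ 0 := pow_ne_zero 3 hn
  apply mul_left_cancel₀ h3
  have hinv : ((n : ℝ) + 1) ^ 3 * (1 / ((n + 1 : ℕ) : ℝ)) ^ 2 = n + 1 := by
    push_cast; field_simp
  push_cast at hrec hinv ⊢
  split_ifs at hrec ⊢ with h0
  · linear_combination hrec + ((i + 2) * (i + 1) ^ 2 * (b (n + 1) (i + 1) + b (n + 1) (i + 3)) +
      (i - 1) * (2 * i ^ 2) * (b (n + 1) (i - 1) + b (n + 1) (i + 1)) +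
      (i - 1) * (i - 2) * (i - 3) * (b (n + 1) (i - 3) + b (n + 1) (i - 1))) * hinv
  · linear_combination hrec + ((i + 2) * (i + 1) ^ 2 * (b (n + 1) (i + 1) + b (n + 1) (i + 3)) +
      (i - 1) * (2 * i ^ 2) * (b (n + 1) (i - 1) + b (n + 1) (i + 1)) +
      (i - 1) * (i - 2) * (i - 3) * (b (n + 1) (i - 3) + b (n + 1) (i - 1))) * hinv

theorem hasAnalyticExpansion_coeff {ahat : ℝ} (hahat : 0 < ahat) (i : ℤ) :
    HasAnalyticExpansion fun N =>
      1 / (N : ℝ) * (cauchyResolvent 2 N (ahat * 2 * N / 2)).coeff i := by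
  set b : ℕ → ℤ → ℝ := fun N i =>
    1 / (N : ℝ) * (cauchyResolvent 2 N (ahat * 2 * N / 2)).coeff i with hb
  have hlim : Tendsto (fun N : ℕ => ahat * (N : ℝ)) atTop atTop :=
    tendsto_natCast_atTop_atTop.const_mul_atTop hahat
  suffices h : ∀ k : ℕ, ∀ i : ℤ, i ≤ k → HasAnalyticExpansion fun N => b N i from
    h i.toNat i (Int.self_le_toNat i)
  intro k
  induction k with
  | zero =>
    intro i hi
    refine (HasAnalyticExpansion.of_analyticAt (f := fun _ => 0) analyticAt_const).congr
      (Eventually.of_forall fun N => ?_)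
    simp only [hb]
    rw [cauchyResolvent_coeff_of_nonpos _ _ _ (by simpa using hi), mul_zero]
  | succ k ih =>
    intro i hi
    rcases lt_or_eq_of_le hi with hi | rfl
    · exact ih i (by push_cast at hi; omega)
    push_cast
    rcases Nat.eq_zero_or_pos k with rfl | hk
    · refine (HasAnalyticExpansion.of_analyticAt (f := fun _ => 1) analyticAt_const).congr ?_
      filter_upwards [eventually_gt_atTop 0] with N hN
      obtain ⟨n, rfl⟩ : ∃ n, N = n + 1 := ⟨N - 1, by omega⟩
      have hn : ((n : ℝ) + 1) ≠ 0 := by positivity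
      simp only [hb, Nat.cast_zero, zero_add]
      rw [cauchyResolvent_coeff_one n (by positivity)]
      push_cast
      field_simp
    -- The recurrence at index m has top coefficient b(m + 3) = b(k + 1). In z = 1/N its factor is
    -- (m + 2)(4α̂² - (m + 1)²z²), nonzero at z = 0 because k ≥ 1, so division preserves
    -- analyticity.
    · set m : ℤ := (k : ℤ) - 2 with hm
      have hm1 : (1 : ℝ) ≤ (m : ℝ) + 2 := by
        have : 1 ≤ m + 2 := by omega
        exact_mod_cast this
      have e1 := ih (m + 1) (by omega)
      have e2 := ih (m - 1) (by omega)
      have e3 := ih (m - 3) (by omega)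
      have hden : ((m : ℝ) + 2) * (4 * ahat ^ 2 - (m + 1) ^ 2 * 0 ^ 2) ≠ 0 := by
        have : 0 < ahat ^ 2 := by positivity
        have : 0 < (m : ℝ) + 2 := by linarith
        rw [zero_pow two_ne_zero, mul_zero, sub_zero]
        positivity
      have hA : ∀ r s : ℝ, HasAnalyticExpansion fun N : ℕ => (r + s * (1 / (N : ℝ)) ^ 2) /
          (((m : ℝ) + 2) * (4 * ahat ^ 2 - (m + 1) ^ 2 * (1 / (N : ℝ)) ^ 2)) := fun r s =>
        HasAnalyticExpansion.of_analyticAt (f := fun z => (r + s * z ^ 2) /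
          (((m : ℝ) + 2) * (4 * ahat ^ 2 - (m + 1) ^ 2 * z ^ 2)))
          (AnalyticAt.div (by fun_prop) (by fun_prop) hden)
      have hne : ∀ᶠ N : ℕ in atTop,
          ((m : ℝ) + 2) * (4 * ahat ^ 2 - (m + 1) ^ 2 * (1 / (N : ℝ)) ^ 2) ≠ 0 := by
        refine tendsto_one_div_atTop_nhds_zero_nat.eventually (p := fun z : ℝ =>
          ((m : ℝ) + 2) * (4 * ahat ^ 2 - (m + 1) ^ 2 * z ^ 2) ≠ 0) ?_
        exact ContinuousAt.eventually_ne (by fun_prop) hden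
      refine (((hA (if m = 0 then 4 * ((ahat + 1) * (2 * ahat + 1)) else 0) 0).add
        ((hA (-(4 * ahat ^ 2 * (m + 2)) + 4 * (m - 1) * (2 * ahat + 1))
          ((m + 2) * (m + 1) ^ 2 + (m - 1) * (2 * m ^ 2))).mul e1)).add
        (((hA (4 * (m - 1) * (2 * ahat + 1))
          ((m - 1) * (2 * m ^ 2) + (m - 1) * (m - 2) * (m - 3))).mul e2).add
          ((hA 0 ((m - 1) * (m - 2) * (m - 3))).mul e3))).congr ?_
      filter_upwards [eventually_scaled_recurrence hahat (b := b) (fun _ _ => rfl) m, hne]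
        with N hrec hN
      rw [show (k : ℤ) + 1 = m + 3 by omega]
      simp only [div_mul_eq_mul_div, ← add_div]
      rw [eq_div_iff hN]
      split_ifs at hrec ⊢
      · linear_combination -hrec
      · linear_combination -hrec

theorem IsResolventExpansion.eq {β ahat : ℝ} {W W' : ℕ → LaurentSeries ℝ}
    (h : IsResolventExpansion β ahat W) (h' : IsResolventExpansion β ahat W') : W = W' := by
  funext l
  ext i
  rw [← sub_eq_zero]
  refine eq_zero_of_eventually_hasSum_div_pow
    (a := fun l => (W l).coeff i - (W' l).coeff i) ?_ l
  filter_upwards [h i, h' i] with N h1 h2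
  simpa [sub_div] using h1.sub h2

theorem exists_isResolventExpansion {ahat : ℝ} (hahat : 0 < ahat) :
    ∃ W, IsResolventExpansion 2 ahat W := by
  choose a ha using fun k : ℕ =>
    (hasAnalyticExpansion_coeff hahat ((k : ℤ) + 1)).exists_hasSum
  refine ⟨fun l => HahnSeries.single 1 1 *
    HahnSeries.ofPowerSeries ℤ ℝ (PowerSeries.mk fun k => a k l), fun i => ?_⟩
  rcases lt_or_ge 0 i with hi | hi
  · obtain ⟨k, rfl⟩ : ∃ k : ℕ, i = k + 1 := ⟨(i - 1).toNat, by omega⟩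
    simpa only [HahnSeries.coeff_single_mul, one_mul, add_sub_cancel_right,
      HahnSeries.ofPowerSeries_apply_coeff, PowerSeries.coeff_mk] using ha k
  · refine Eventually.of_forall fun N => ?_
    rw [cauchyResolvent_coeff_of_nonpos _ _ _ hi, mul_zero]
    convert hasSum_zero with l
    rw [HahnSeries.coeff_single_mul, one_mul, PowerSeries.coeff_coe, if_pos (by omega), zero_div]

theorem IsResolventExpansion.coeff_recurrence {ahat : ℝ} (hahat : 0 < ahat)
    {W : ℕ → LaurentSeries ℝ} (hW : IsResolventExpansion 2 ahat W) (i : ℤ) (l : ℕ) :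
    4 * (firstOrderOp ahat (W l)).coeff i =
      (if 2 ≤ l then (thirdOrderOp (W (l - 2))).coeff i else 0) +
        if l = 0 then (if i = 0 then -(4 * ((ahat + 1) * (2 * ahat + 1))) else 0) else 0 := by
  set κ : ℝ := if i = 0 then -(4 * ((ahat + 1) * (2 * ahat + 1))) else 0 with hκ
  rw [← sub_eq_zero]
  refine eq_zero_of_eventually_hasSum_div_pow (a := fun l =>
    4 * (firstOrderOp ahat (W l)).coeff i -
      ((if 2 ≤ l then (thirdOrderOp (W (l - 2))).coeff i else 0) + if l = 0 then κ else 0)) ?_ l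
  filter_upwards [eventually_scaled_recurrence hahat (fun _ _ => rfl) i, hW (i + 1), hW (i + 3),
    hW (i - 1), hW (i - 3), eventually_gt_atTop 0] with N hrec h1 h3 h1' h3' hN
  have hN' : (N : ℝ) ≠ 0 := by exact_mod_cast hN.ne'
  have hfirst := (((h1.add h3).mul_left (-ahat ^ 2 * ((i : ℝ) + 2))).add
    ((h1'.add h1).mul_left (((i : ℝ) - 1) * (2 * ahat + 1)))).mul_left 4
  have hthird := (((((h1.add h3).mul_left (((i : ℝ) + 2) * (i + 1) ^ 2)).add
    ((h1'.add h1).mul_left (((i : ℝ) - 1) * (2 * i ^ 2)))).add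
    ((h3'.add h1').mul_left (((i : ℝ) - 1) * (i - 2) * (i - 3)))).neg).mul_right
      ((1 / (N : ℝ)) ^ 2)
  -- The factor N⁻² moves the contribution of W_l to order l + 2; orders 0 and 1 receive nothing.
  have hshift := (hasSum_nat_add_iff (f := fun l =>
    (if 2 ≤ l then (thirdOrderOp (W (l - 2))).coeff i else 0) / (N : ℝ) ^ l) 2).mp
      (hasSum_of_forall_eq hthird fun l => by
        rw [if_pos (by omega), Nat.add_sub_cancel, thirdOrderOp_coeff, pow_add]
        field_simp)
  have hconst : HasSum (fun l => (if l = 0 then κ else 0) / (N : ℝ) ^ l) κ := by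
    convert hasSum_ite_eq 0 κ using 2 with l
    by_cases hl : l = 0 <;> simp [hl]
  have hall := hfirst.sub (hshift.add hconst)
  convert hasSum_of_forall_eq hall fun l => ?_ using 1
  · have hsum : ∑ l ∈ Finset.range 2,
        (if 2 ≤ l then (thirdOrderOp (W (l - 2))).coeff i else 0) / (N : ℝ) ^ l = 0 :=
      Finset.sum_eq_zero fun l hl => by
        rw [if_neg (by simpa using hl), zero_div]
    rw [← hκ] at hrec
    rw [hsum]
    linear_combination -hrec
  · rw [firstOrderOp_coeff]
    ring

theorem proposition4p10 (ahat : ℝ) (hahat : 0 < ahat) :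
    (∀ k : ℕ, ∀ᶠ N : ℕ in atTop,
      Integrable (fun y : ℝ => y ^ k * cauchyDensity 2 N (ahat * 2 * N / 2) y)) ∧
    (∃! W : ℕ → LaurentSeries ℝ, IsResolventExpansion 2 ahat W) ∧
    ∀ W : ℕ → LaurentSeries ℝ, IsResolventExpansion 2 ahat W →
      firstOrderOp ahat (W 0) = HahnSeries.C (-((ahat + 1) * (2 * ahat + 1))) ∧
      firstOrderOp ahat (W 1) = 0 ∧
      ∀ l : ℕ, 2 ≤ l →
        4 * firstOrderOp ahat (W l) =
          (1 + xVar ^ 2) ^ 3 * ddx (ddx (ddx (W (l - 2))))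
            + 8 * (1 + xVar ^ 2) ^ 2 * xVar * ddx (ddx (W (l - 2)))
            + 2 * (1 + xVar ^ 2) * (7 * xVar ^ 2 + 3) * ddx (W (l - 2))
            + 4 * (1 + xVar ^ 2) * xVar * W (l - 2) := by
  refine ⟨fun k => ?_, ?_, fun W hW => ⟨?_, ?_, fun l hl => ?_⟩⟩
  · have hlim : Tendsto (fun N : ℕ => 2 * ahat * (N : ℝ)) atTop atTop :=
      tendsto_natCast_atTop_atTop.const_mul_atTop (by linarith)
    filter_upwards [hlim.eventually_gt_atTop (k : ℝ), eventually_gt_atTop 0] with N hN hN0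
    obtain ⟨n, rfl⟩ : ∃ n, N = n + 1 := ⟨N - 1, by omega⟩
    exact integrable_pow_mul_cauchyDensity (by positivity) (by linarith)
  · obtain ⟨W, hW⟩ := exists_isResolventExpansion hahat
    exact ⟨W, hW, fun W' hW' => hW'.eq hW⟩
  · ext i
    have h := hW.coeff_recurrence hahat i 0
    rw [if_neg (by omega), if_pos rfl, zero_add] at h
    rw [HahnSeries.C_apply]
    by_cases hi : i = 0
    · subst hi
      rw [if_pos rfl] at h
      rw [HahnSeries.coeff_single_same]
      linarith
    · rw [if_neg hi] at h
      rw [HahnSeries.coeff_single_of_ne hi]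
      linarith
  · ext i
    have h := hW.coeff_recurrence hahat i 1
    rw [if_neg (by omega), if_neg (by omega), zero_add] at h
    rw [HahnSeries.coeff_zero]
    linarith
  · change _ = thirdOrderOp (W (l - 2))
    ext i
    have h := hW.coeff_recurrence hahat i l
    rw [if_pos hl, if_neg (by omega), add_zero, ← C_mul_coeff, map_ofNat] at h
    exact h
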